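/- Conventions. All digraphs $D=(V(D),E(D))$, $E(D)\subseteq V(D)\times V(D)$, are finite and have no loops; both $(u,v)$ and $(v,u)$ may be edges. For $v\in V(D)$ and $A,B\subseteq V(D)$ let $\deg^+(v,B)=|\{w\in B:(v,w)\in E(D)\}|$, $\deg^-(v,A)=|\{u\in A:(u,v)\in E(D)\}|$, $\Delta^+(A,B)=\max_{v\in A}\deg^+(v,B)$ and $\Delta^-(B,A)=\max_{v\in B}\deg^-(v,A)$. The minimum semi-degree $\delta^0(D)$ is the minimum of all out-degrees and all in-degrees of vertices of $D$. A digraph $D$ on $2n$ vertices is $\alpha$-extremal if there are (not necessarily disjoint) sets $A,B\subseteq V(D)$ with $(1-\alpha)n\le |A|,|B|\le(1+\alpha)n$, $\Delta^+(A,B)\le\alpha n$ and $\Delta^-(B,A)\le\alpha n$. An anti-directed cycle is a digraph whose underlying graph is a cycle and in which no pair of consecutive edges forms a directed path; an anti-directed Hamiltonian cycle in $D$ is a subdigraph of $D$ that is an anti-directed cycle and contains all vertices of $D$. Theorem. For every $\alpha\in(0,1/32)$ there exist $\varepsilon>0$ and $n_0\in\mathbb N$ such that the following holds for all $n\ge n_0$: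 if $D$ is a digraph on $2n$ vertices that is not $\alpha$-extremal and satisfies $\delta^0(D)\ge(1-\varepsilon)n$, then $D$ contains an anti-directed Hamiltonian cycle. -/

import Mathlib

open scoped Classical in
/-- `deg⁺(v, B)`: the number of out-neighbours of `v` in `B`. -/
noncomputable def Digraph.outDegIn {V : Type*} (D : Digraph V) (v : V) (B : Finset V) : ℕ :=
  (B.filter fun w => D.Adj v w).card

open scoped Classical in
/-- `deg⁻(v, A)`: the number of in-neighbours of `v` in `A`. -/
noncomputable def Digraph.inDegIn {V : Type*} (D : Digraph V) (v : V) (A : Finset V) : ℕ :=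
  (A.filter fun u => D.Adj u v).card

/-- `Δ⁺(A, B)`: the maximum of `deg⁺(v, B)` over `v ∈ A`. -/
noncomputable def Digraph.maxOutDeg {V : Type*} (D : Digraph V) (A B : Finset V) : ℕ :=
  A.sup fun v => D.outDegIn v B

/-- `Δ⁻(B, A)`: the maximum of `deg⁻(v, A)` over `v ∈ B`. -/
noncomputable def Digraph.maxInDeg {V : Type*} (D : Digraph V) (B A : Finset V) : ℕ :=
  B.sup fun v => D.inDegIn v A

/-- `δ⁰(D) = min {δ⁺(D), δ⁻(D)}`: the minimum semi-degree (of a nonempty finite digraph). -/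
noncomputable def Digraph.minSemidegree {V : Type*} [Fintype V] (D : Digraph V) : ℕ :=
  min (⨅ v : V, D.outDegIn v Finset.univ) (⨅ v : V, D.inDegIn v Finset.univ)

/-- A digraph `D` on `2n` vertices is `α`-extremal. The sets `A` and `B` may overlap. -/
def Digraph.IsExtremal {V : Type*} (D : Digraph V) (n : ℕ) (α : ℝ) : Prop :=
  ∃ A B : Finset V,
    ((1 - α) * n ≤ (A.card : ℝ) ∧ (A.card : ℝ) ≤ (1 + α) * n) ∧
    ((1 - α) * n ≤ (B.card : ℝ) ∧ (B.card : ℝ) ≤ (1 + α) * n) ∧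
    (D.maxOutDeg A B : ℝ) ≤ α * n ∧
    (D.maxInDeg B A : ℝ) ≤ α * n

/-- The digraph `H`, with vertex set `V`, is an anti-directed cycle: its underlying graph is a cycle
(through all of `V`), and no two edges `(u, v)`, `(v, w)` of `H` follow each other head to tail.
The last condition (with `w = u`) also says that `H` has each edge in one direction only. -/
structure Digraph.IsAntidirectedCycle {V : Type*} [Fintype V] (H : Digraph V) : Prop where
  three_le_card : 3 ≤ Fintype.card V
  underlying_isCycle :
    Nonempty (H.toSimpleGraphInclusive ≃g SimpleGraph.cycleGraph (Fintype.card V))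
  not_directed : ∀ u v w : V, H.Adj u v → ¬ H.Adj v w

/-- `D` contains an anti-directed Hamiltonian cycle: an anti-directed cycle is a spanning
subdigraph of `D`. -/
def Digraph.HasAntidirectedHamiltonianCycle {V : Type*} [Fintype V] (D : Digraph V) : Prop :=
  ∃ H : Digraph V, H ≤ D ∧ H.IsAntidirectedCycle

/-! Fix a set `S` of half of the vertices and keep only the edges directed from `S` to its
complement. In the resulting bipartite graph every vertex is a source or a sink, so a Hamiltonian
cycle of this graph is an anti-directed Hamiltonian cycle of `D`.

`S` is chosen so that it nearly halves polynomially many test sets (`exists_bisection`, a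
derandomised Chernoff bound). All degrees in the bipartite graph are then at least about n/2, which
is just short of forcing a Hamiltonian cycle.

Take a cyclic ordering with the fewest non-edges. If it is not a Hamiltonian cycle, cut it at a
non-edge, leaving end vertices `y` (first) and `x` (last). By minimality, no sequence of Pósa
rotations along edges can produce an ordering with adjacent ends. Two, three and four exchanges give
rigid constraints on adjacency in terms of the positions `X` of the neighbours of `x` and `Y` of the
neighbours of `y`. Counting with these constraints shows that the non-neighbours of `x` and the
non-neighbours of `y` span only O(ηn) edges, where η bounds the degree deficit n - 2δ
(`card_adj_outside_le`, `hamiltonian_or_sparse`).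

In `D`, the non-in-neighbours of `y` and the non-out-neighbours of `x` are two sets of size about n.
Since `D` is not extremal, quadratically many edges go from the first to the second, and the
bisection retains a constant fraction of them: a contradiction once ε is small compared with α². -/

/-! ### Orderings, rotations and exchanges -/

section PathCost

variable {V : Type*} (c : V → V → ℕ)

/-- The total cost of the consecutive pairs of a list. -/
def pathCost : List V → ℕ
  | [] => 0
  | [_] => 0
  | a :: b :: l => c a b + pathCost (b :: l)

theorem pathCost_append_cons (A : List V) (a b : V) (B : List V) :
    pathCost c (A ++ a :: b :: B) = pathCost c (A ++ [a]) + c a b + pathCost c (b :: B) := by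
  induction A with
  | nil => simp [pathCost]
  | cons u A ih =>
    cases A with
    | nil => simp [pathCost]; ring
    | cons v A =>
      simp only [List.cons_append, pathCost] at ih ⊢
      omega

theorem pathCost_append (A B : List V) (a b : V) (ha : A.getLast? = some a)
    (hb : B.head? = some b) :
    pathCost c (A ++ B) = pathCost c A + c a b + pathCost c B := by
  obtain ⟨A', rfl⟩ : ∃ A', A = A' ++ [a] := List.getLast?_eq_some_iff.1 ha
  obtain ⟨B', rfl⟩ : ∃ B', B = b :: B' := List.head?_eq_some_iff.1 hb
  rw [List.append_assoc, List.singleton_append, pathCost_append_cons]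

variable {c}

theorem pathCost_reverse (hc : ∀ a b, c a b = c b a) (L : List V) :
    pathCost c L.reverse = pathCost c L := by
  induction L with
  | nil => rfl
  | cons u L ih =>
    cases L with
    | nil => rfl
    | cons v L =>
      rw [List.reverse_cons, pathCost_append c _ [u] v u (by simp) rfl, ih]
      simp [pathCost, hc v u, add_comm]

/-- An ordering of the elements of `L₀` whose path cost is at most `m`. -/
def IsTight (c : V → V → ℕ) (L₀ : List V) (m : ℕ) (L : List V) : Prop :=
  L.Perm L₀ ∧ pathCost c L ≤ m

variable {L₀ : List V} {m : ℕ} {A B : List V} {a b x y : V}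

/-- Pósa rotation: reversing the tail `B` replaces the pair at the junction by `a, x`, which is
free, and changes no other cost. -/
theorem IsTight.rotate_right (hc : ∀ a b, c a b = c b a) (h : IsTight c L₀ m (A ++ B))
    (ha : A.getLast? = some a) (hx : B.getLast? = some x) (hax : c a x = 0) :
    IsTight c L₀ m (A ++ B.reverse) := by
  refine ⟨((List.reverse_perm B).append_left A).trans h.1, ?_⟩
  obtain ⟨b, hb⟩ : ∃ b, B.head? = some b := by
    cases B with
    | nil => simp at hx
    | cons b B => exact ⟨b, rfl⟩
  have h2 := h.2
  rw [pathCost_append c A B a b ha hb] at h2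
  rw [pathCost_append c A B.reverse a x ha (by simpa using hx), pathCost_reverse hc]
  omega

theorem IsTight.rotate_left (hc : ∀ a b, c a b = c b a) (h : IsTight c L₀ m (A ++ B))
    (hy : A.head? = some y) (hb : B.head? = some b) (hyb : c y b = 0) :
    IsTight c L₀ m (A.reverse ++ B) := by
  refine ⟨((List.reverse_perm A).append_right B).trans h.1, ?_⟩
  obtain ⟨a, ha⟩ : ∃ a, A.getLast? = some a := by
    cases A with
    | nil => simp at hy
    | cons b B => exact ⟨_, List.getLast?_eq_some_getLast (by simp)⟩
  have h2 := h.2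
  rw [pathCost_append c A B a b ha hb] at h2
  rw [pathCost_append c A.reverse B y b (by simpa using hy) hb, pathCost_reverse hc]
  omega

/-- The segment `g a, …, g (b - 1)` of a sequence. -/
def seg (g : ℕ → V) (a b : ℕ) : List V := (List.Ico a b).map g

theorem seg_append (g : ℕ → V) {a b d : ℕ} (h₁ : a ≤ b) (h₂ : b ≤ d) :
    seg g a d = seg g a b ++ seg g b d := by
  rw [seg, seg, seg, ← List.map_append, List.Ico.append_consecutive h₁ h₂]

theorem head?_seg (g : ℕ → V) {a b : ℕ} (h : a < b) : (seg g a b).head? = some (g a) := by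
  simp [seg, List.Ico.eq_cons h]

theorem getLast?_seg (g : ℕ → V) {a b : ℕ} (h : a < b) :
    (seg g a b).getLast? = some (g (b - 1)) := by
  obtain ⟨b, rfl⟩ : ∃ k, b = k + 1 := ⟨b - 1, by omega⟩
  simp [seg, List.Ico.succ_top (Nat.lt_succ_iff.1 h)]

variable {g : ℕ → V} {N p q r : ℕ}

/-- The ordering obtained from the chords `p, N - 1` and `0, q`. -/
theorem IsTight.double_rotate (hc : ∀ a b, c a b = c b a) (hg : IsTight c L₀ m (seg g 0 N))
    (hpq : p < q) (hq : q + 1 < N) (hx : c (g p) (g (N - 1)) = 0)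
    (hy : c (g 0) (g q) = 0) :
    IsTight c L₀ m (seg g (q + 1) N ++ ((seg g 0 (p + 1)).reverse ++
      (seg g (p + 1) (q + 1)).reverse)) := by
  have hp : p + 1 < N := by omega
  rw [seg_append g (Nat.zero_le (p + 1)) hp.le] at hg
  -- The order becomes 0..p, N-1..p+1. Its prefix ending at q+1 is then reversed, along the chord
  -- from 0 to q.
  have h1 := hg.rotate_right hc (getLast?_seg g (by omega)) (getLast?_seg g hp) (by simpa using hx)
  rw [seg_append g (show p + 1 ≤ q + 1 by omega) hq.le, List.reverse_append,
    ← List.append_assoc] at h1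
  have h2 := h1.rotate_left hc (by rw [List.head?_append, head?_seg g (by omega)]; rfl)
    (by rw [List.head?_reverse, getLast?_seg g (by omega)]) (by simpa using hy)
  simpa using h2

section Exchange

variable (hc : ∀ a b, c a b = c b a)
  (hend : ∀ L x y, IsTight c L₀ m L → L.head? = some y → L.getLast? = some x → c y x ≠ 0)
  (hg : IsTight c L₀ m (seg g 0 N))
include hc hend hg

/-- Hypothesis `hend` says that no tight ordering closes up for free. Each exchange lemma rotates
along free chords to another tight ordering and applies `hend` to its new ends. Here the ends are 0
and p+1. -/
theorem two_exchange (hp : p + 1 < N) (hx : c (g p) (g (N - 1)) = 0) :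
    c (g 0) (g (p + 1)) ≠ 0 := by
  rw [seg_append g (Nat.zero_le (p + 1)) hp.le] at hg
  have h1 := hg.rotate_right hc (getLast?_seg g (by omega)) (getLast?_seg g hp) (by simpa using hx)
  exact hend _ _ _ h1 (by simp [head?_seg]) (by simp [head?_seg, hp])

theorem three_exchange_left (hp : p + 1 < N) (hq : q + 1 ≤ p) (hx : c (g p) (g (N - 1)) = 0)
    (hy : c (g 0) (g (q + 1)) = 0) : c (g q) (g (p + 1)) ≠ 0 := by
  rw [seg_append g (Nat.zero_le (p + 1)) hp.le] at hg
  have h1 := hg.rotate_right hc (getLast?_seg g (by omega)) (getLast?_seg g hp) (by simpa using hx)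
  rw [seg_append g (Nat.zero_le (q + 1)) (show q + 1 ≤ p + 1 by omega), List.append_assoc] at h1
  have h2 := h1.rotate_left hc (head?_seg g (by omega))
    (by rw [List.head?_append, head?_seg g (by omega)]; rfl) hy
  exact hend _ _ _ h2 (by simp [getLast?_seg]) (by simp [head?_seg, hp])

theorem three_exchange_right (hpq : p < q) (hq : q + 1 < N) (hx : c (g p) (g (N - 1)) = 0)
    (hy : c (g 0) (g q) = 0) : c (g (q + 1)) (g (p + 1)) ≠ 0 := by
  have h := hg.double_rotate hc hpq hq hx hy
  exact hend _ _ _ h (by simp [head?_seg, hq]) (by simp [head?_seg, hpq])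

/-- After the double rotation the order is q+1..N-1, p..0, q..p+1. The three four-exchange lemmas
rotate its last end p+1 once more, with the cut in the first, second or third of these blocks. -/
theorem four_exchange_right (hpq : p < q) (hx : c (g p) (g (N - 1)) = 0)
    (hy : c (g 0) (g q) = 0) (hr : q < r) (hrN : r + 1 < N) (h1 : c (g r) (g (p + 1)) = 0) :
    c (g (q + 1)) (g (r + 1)) ≠ 0 := by
  have h := hg.double_rotate hc hpq (by omega) hx hy
  rw [seg_append g (show q + 1 ≤ r + 1 by omega) hrN.le, List.append_assoc] at h
  have h2 := h.rotate_right hc (getLast?_seg g (by omega))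
    (by simp [head?_seg, hpq]; rfl) (by simpa using h1)
  exact hend _ _ _ h2 (by simp [head?_seg, hr]) (by simp [head?_seg, hrN])

theorem four_exchange_left (hpq : p < q) (hq : q + 1 < N) (hx : c (g p) (g (N - 1)) = 0)
    (hy : c (g 0) (g q) = 0) (hr : r + 1 ≤ p) (h1 : c (g (r + 1)) (g (p + 1)) = 0) :
    c (g (q + 1)) (g r) ≠ 0 := by
  have h := hg.double_rotate hc hpq hq hx hy
  rw [seg_append g (Nat.zero_le (r + 1)) (show r + 1 ≤ p + 1 by omega), List.reverse_append,
    List.append_assoc, ← List.append_assoc] at h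
  have h2 := h.rotate_right hc (a := g (r + 1)) (x := g (p + 1))
    (by simp [head?_seg, show r + 1 < p + 1 by omega])
    (by simp [head?_seg, hpq]) h1
  refine hend _ _ _ h2 (by simp [head?_seg, hq]) ?_
  simp [getLast?_seg]

theorem four_exchange_middle (hpq : p < q) (hq : q + 1 < N) (hx : c (g p) (g (N - 1)) = 0)
    (hy : c (g 0) (g q) = 0) (hpr : p + 1 ≤ r) (hr : r + 1 ≤ q)
    (h1 : c (g (r + 1)) (g (p + 1)) = 0) :
    c (g (q + 1)) (g r) ≠ 0 := by
  have h := hg.double_rotate hc hpq hq hx hy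
  rw [seg_append g (show p + 1 ≤ r + 1 by omega) (show r + 1 ≤ q + 1 by omega),
    List.reverse_append, ← List.append_assoc, ← List.append_assoc] at h
  have h2 := h.rotate_right hc (a := g (r + 1)) (x := g (p + 1))
    (by simp [head?_seg, show r + 1 < q + 1 by omega])
    (by simp [head?_seg, show p + 1 < r + 1 by omega]) h1
  refine hend _ _ _ h2 (by simp [head?_seg, hq]) ?_
  simp [getLast?_seg, show p + 1 < r + 1 by omega]

end Exchange

end PathCost

/-! ### Counting the adjacencies allowed by the exchange constraints -/

section ExchangeCount

open Finset

open scoped Classical in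
-- Each element of `Y` forces a non-neighbour of row `i`: itself if it lies before `i`, its
-- successor if after. These are at least δ distinct positions; with the at least δ neighbours they
-- fill all but η positions, so few other non-neighbours remain.
theorem card_nonadj_outside_shift_le {n δ η : ℕ} (hη : n ≤ 2 * δ + η) {Y : Finset ℕ}
    (hY : Y ⊆ range n) (hδY : δ ≤ #Y) (hlast : n - 1 ∉ Y) {r : ℕ → Prop} {i : ℕ}
    (hrow : δ ≤ #{j ∈ range n | r j}) (hi : i ∉ Y)
    (h2 : ∀ j ∈ Y, j < i → ¬ r j) (h3 : ∀ j ∈ Y, i < j → j + 1 < n → ¬ r (j + 1)) :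
    #{a ∈ range n | ¬ r a ∧ ¬ (a < i ∧ a ∈ Y) ∧ ¬ (i + 2 ≤ a ∧ a - 1 ∈ Y)} ≤ η := by
  set Z := Y.image (fun j => if j < i then j else j + 1) with hZ
  have hlt : ∀ j ∈ Y, j + 1 < n := fun j hj => by
    have h := mem_range.1 (hY hj)
    have : j ≠ n - 1 := fun h => hlast (h ▸ hj)
    omega
  have hZc : #Z = #Y := by
    refine card_image_of_injOn fun a ha b hb h => ?_
    split_ifs at h <;> omega
  have hZr : ∀ a ∈ Z, a < n ∧ ¬ r a ∧ ((a < i ∧ a ∈ Y) ∨ (i + 2 ≤ a ∧ a - 1 ∈ Y)) := by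
    intro a ha
    obtain ⟨j, hj, rfl⟩ := mem_image.1 ha
    have := hlt j hj
    by_cases hji : j < i
    · rw [if_pos hji]
      exact ⟨by omega, h2 j hj hji, Or.inl ⟨hji, hj⟩⟩
    · have hne : j ≠ i := fun h => hi (h ▸ hj)
      rw [if_neg hji]
      exact ⟨this, h3 j hj (by omega) this, Or.inr ⟨by omega, by simpa using hj⟩⟩
  have hsub : ({j ∈ range n | r j} ∪ Z) ∪
      {a ∈ range n | ¬ r a ∧ ¬ (a < i ∧ a ∈ Y) ∧ ¬ (i + 2 ≤ a ∧ a - 1 ∈ Y)} ⊆ range n := by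
    intro a ha
    simp only [mem_union, mem_filter] at ha
    rcases ha with (h | h) | h
    exacts [h.1, mem_range.2 (hZr a h).1, h.1]
  have hcard := card_le_card hsub
  rw [card_union_of_disjoint, card_union_of_disjoint, card_range] at hcard
  · omega
  · rw [disjoint_left]
    exact fun a ha hb => (hZr a hb).2.1 (mem_filter.1 ha).2
  · rw [disjoint_left]
    intro a ha hb
    have hb := (mem_filter.1 hb).2
    rcases mem_union.1 ha with h | h
    · exact hb.1 (mem_filter.1 h).2
    · rcases (hZr a h).2.2 with h | h
      exacts [hb.2.1 h, hb.2.2 h]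

/-- In a 0/1-sequence, ascents and descents differ in number by at most one. -/
theorem card_ascents_le (n : ℕ) (Y : Finset ℕ) :
    #{b ∈ range n | b ∉ Y ∧ b + 1 ∈ Y} ≤ #{b ∈ range n | b ∈ Y ∧ b + 1 ∉ Y} + 1 := by
  suffices h : #{b ∈ range n | b ∉ Y ∧ b + 1 ∈ Y} + (if 0 ∈ Y then 1 else 0) =
      #{b ∈ range n | b ∈ Y ∧ b + 1 ∉ Y} + (if n ∈ Y then 1 else 0) by
    split_ifs at h <;> omega
  induction n with
  | zero => simp
  | succ n ih =>
    rw [range_add_one, filter_insert, filter_insert]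
    by_cases h1 : n ∈ Y <;> by_cases h2 : n + 1 ∈ Y <;>
      simp only [h1, h2, not_true_eq_false, not_false_eq_true, and_true, and_false,
        if_true, if_false] at ih ⊢ <;>
      first
      | exact ih
      | (rw [card_insert_of_notMem (by simp)]; omega)

variable {n δ η : ℕ} {X Y : Finset ℕ} {e : ℕ → ℕ → Prop}

open scoped Classical in
-- Column j+1, with j the maximum of `Y`, has at least δ neighbours `K`. Three disjoint sets almost
-- avoid `K`: `C₁` and `C₂`, which together cover `X` up to two elements, and the set `P` of
-- descents of `Y` between i₁ and i₂. A neighbour in one of them would, by `h4`, `h5` or `h6`, yield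
-- an unexplained non-neighbour of row i₁ or i₂, and each row has at most η of those. There is hence
-- little room for `P`.
theorem card_descents_le (hη : n ≤ 2 * δ + η) (hX : X ⊆ range n) (hY : Y ⊆ range n)
    (hδX : δ ≤ #X) (hδY : δ ≤ #Y) (hlast : n - 1 ∉ Y)
    (hrow : ∀ i < n, δ ≤ #{j ∈ range n | e i j}) (hcol : ∀ j < n, δ ≤ #{i ∈ range n | e i j})
    (h1 : Disjoint X Y) (h2 : ∀ i ∈ X, ∀ j ∈ Y, j < i → ¬ e i j)
    (h3 : ∀ i ∈ X, ∀ j ∈ Y, i < j → j + 1 < n → ¬ e i (j + 1))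
    (h4 : ∀ i ∈ X, ∀ j ∈ Y, i < j → ∀ a, j + 1 < a → a < n → e i a → ¬ e a (j + 1))
    (h5 : ∀ i ∈ X, ∀ j ∈ Y, i < j → j + 1 < n → ∀ b < i, e i (b + 1) → ¬ e b (j + 1))
    (h6 : ∀ i ∈ X, ∀ j ∈ Y, i < j → j + 1 < n → ∀ b, i < b → b < j → e i (b + 1) →
      ¬ e b (j + 1))
    {i₁ j : ℕ} (hi₁ : i₁ ∈ X) (hi₁min : ∀ i ∈ X, i₁ ≤ i) (hj : j ∈ Y) (hjmax : ∀ k ∈ Y, k ≤ j)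
    (hij : i₁ < j) :
    #{b ∈ range n | b ∈ Y ∧ b + 1 ∉ Y} ≤ 5 * η + 4 := by
  have hjn : j + 1 < n := by
    have h := mem_range.1 (hY hj)
    have : j ≠ n - 1 := fun h => hlast (h ▸ hj)
    omega
  obtain ⟨i₂, hi₂, hi₂max⟩ : ∃ i₂ ∈ X.filter (· < j), ∀ i ∈ X.filter (· < j), i ≤ i₂ :=
    exists_max_image _ id ⟨i₁, by simp [hi₁, hij]⟩
  obtain ⟨hi₂X, hi₂j⟩ := mem_filter.1 hi₂
  have hXY : ∀ i ∈ X, i ∉ Y := fun i hi => disjoint_left.1 h1 hi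
  have rowBound : ∀ i ∈ X,
      #{a ∈ range n | ¬ e i a ∧ ¬ (a < i ∧ a ∈ Y) ∧ ¬ (i + 2 ≤ a ∧ a - 1 ∈ Y)} ≤ η := fun i hi =>
    card_nonadj_outside_shift_le hη hY hδY hlast (hrow i (mem_range.1 (hX hi))) (hXY i hi)
      (h2 i hi) (h3 i hi)
  have E1 := rowBound i₁ hi₁
  have E2 := rowBound i₂ hi₂X
  -- indices in neither set
  set U := {b ∈ range n | b ∉ X ∧ b ∉ Y} with hU
  have hUc : #U ≤ η := by
    have hsub : (X ∪ Y) ∪ U ⊆ range n := by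
      refine union_subset (union_subset hX hY) (filter_subset _ _)
    have := card_le_card hsub
    rw [card_union_of_disjoint, card_union_of_disjoint h1, card_range] at this
    · omega
    · rw [disjoint_left]
      intro a ha hb
      have hb := (mem_filter.1 hb).2
      rcases mem_union.1 ha with h | h
      exacts [hb.1 h, hb.2 h]
  set P := {b ∈ range n | i₁ < b ∧ b < i₂ ∧ b ∈ Y ∧ b + 1 ∉ Y} with hP
  set C₁ := {b ∈ range n | i₁ < b ∧ b < j ∧ b ∉ Y} with hC₁
  set C₂ := {b ∈ range n | j + 2 ≤ b} with hC₂
  set W := {a ∈ range n | ¬ e i₁ a ∧ ¬ (a < i₁ ∧ a ∈ Y) ∧ ¬ (i₁ + 2 ≤ a ∧ a - 1 ∈ Y)} with hW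
  set W₂ := {a ∈ range n | ¬ e i₂ a ∧ ¬ (a < i₂ ∧ a ∈ Y) ∧ ¬ (i₂ + 2 ≤ a ∧ a - 1 ∈ Y)} with hW₂
  set K := {b ∈ range n | e b (j + 1)} with hK
  have hKc : δ ≤ #K := hcol (j + 1) hjn
  have A1 : #(C₁ ∩ K) ≤ η := by
    refine (card_le_card_of_injOn (· + 1) ?_ (fun a _ b _ h => by simpa using h)).trans E1
    intro b hb
    simp only [hC₁, hK, hW, coe_inter, coe_filter, mem_range, Set.mem_inter_iff, Set.mem_ofPred_eq] at hb ⊢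
    refine ⟨by omega, fun h => h6 i₁ hi₁ j hj hij hjn b hb.1.2.1 hb.1.2.2.1 h hb.2.2, by omega, ?_⟩
    rintro ⟨_, h⟩
    exact hb.1.2.2.2 (by simpa using h)
  have A2 : #(C₂ ∩ K) ≤ η := by
    refine (card_le_card ?_).trans E1
    intro b hb
    simp only [hC₂, hK, hW, mem_inter, mem_filter, mem_range] at hb ⊢
    refine ⟨hb.1.1, fun h => h4 i₁ hi₁ j hj hij b (by omega) hb.1.1 h hb.2.2, by omega, ?_⟩
    rintro ⟨_, h⟩
    have := hjmax _ h
    omega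
  have A3 : #(P ∩ K) ≤ η := by
    refine (card_le_card_of_injOn (· + 1) ?_ (fun a _ b _ h => by simpa using h)).trans E2
    intro b hb
    simp only [hP, hK, hW₂, coe_inter, coe_filter, mem_range, Set.mem_inter_iff, Set.mem_ofPred_eq] at hb ⊢
    refine ⟨by omega, fun h => h5 i₂ hi₂X j hj hi₂j hjn b hb.1.2.2.1 h hb.2.2, ?_, by omega⟩
    rintro ⟨_, h⟩
    exact hb.1.2.2.2.2 h
  have hPY : P ⊆ Y := fun b hb => (mem_filter.1 hb).2.2.2.1
  have hC : #(C₁ ∪ C₂ ∪ P) = #C₁ + #C₂ + #P := by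
    rw [card_union_of_disjoint, card_union_of_disjoint]
    · rw [disjoint_left]
      intro b hb hb'
      have := (mem_filter.1 hb).2
      have := (mem_filter.1 hb').2
      omega
    · rw [disjoint_left]
      intro b hb hb'
      have h := hPY hb'
      rcases mem_union.1 hb with h' | h'
      · exact (mem_filter.1 h').2.2.2 h
      · have := (mem_filter.1 h').2
        have := hjmax b h
        omega
  have hCK : #((C₁ ∪ C₂ ∪ P) ∩ K) ≤ 3 * η := by
    rw [union_inter_distrib_right, union_inter_distrib_right]
    have := card_union_le (C₁ ∩ K ∪ C₂ ∩ K) (P ∩ K)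
    have := card_union_le (C₁ ∩ K) (C₂ ∩ K)
    omega
  have hCKn : #(C₁ ∪ C₂ ∪ P) + #K ≤ n + 3 * η := by
    have h := card_union_add_card_inter (C₁ ∪ C₂ ∪ P) K
    have h' : #((C₁ ∪ C₂ ∪ P) ∪ K) ≤ n := by
      rw [← card_range n]
      refine card_le_card (union_subset (union_subset (union_subset ?_ ?_) ?_) ?_) <;>
        exact filter_subset _ _
    omega
  have hXC : #X ≤ #C₁ + #C₂ + 2 := by
    have hsub : X ⊆ (C₁ ∪ C₂) ∪ {i₁, j + 1} := by
      intro b hb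
      have hbn := mem_range.1 (hX hb)
      have hbY := hXY b hb
      have := hi₁min b hb
      have hbj : b ≠ j := fun h => hbY (h ▸ hj)
      simp only [hC₁, hC₂, mem_union, mem_filter, mem_range, mem_insert, mem_singleton]
      by_cases h1 : b = i₁
      · simp [h1]
      · by_cases h2 : b < j
        · exact Or.inl (Or.inl ⟨hbn, by omega, h2, hbY⟩)
        · by_cases h3 : b = j + 1
          · simp [h3]
          · exact Or.inl (Or.inr ⟨hbn, by omega⟩)
    have h1 := card_le_card hsub
    have h2 := card_union_le (C₁ ∪ C₂) {i₁, j + 1}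
    have h3 := card_union_le C₁ C₂
    have h4 : #({i₁, j + 1} : Finset ℕ) ≤ 2 := card_le_two
    omega
  -- From #P + (δ - 2) + δ ≤ n + 3η and n ≤ 2δ + η.
  have hPc : #P ≤ 4 * η + 2 := by omega
  -- A descent outside `P` is i₁ - 1 or j, or its successor lies in neither `X` nor `Y`.
  have hQ : #{b ∈ range n | b ∈ Y ∧ b + 1 ∉ Y} ≤ #(P ∪ {i₁ - 1, j}) + #U := by
    have hsub : {b ∈ range n | b ∈ Y ∧ b + 1 ∉ Y} ⊆ (P ∪ {i₁ - 1, j}) ∪ U.image (· - 1) := by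
      intro b hb
      obtain ⟨hbn, hbY, hbY'⟩ := mem_filter.1 hb
      have hbn := mem_range.1 hbn
      have hbj := hjmax b hbY
      have hbi₁ : b ≠ i₁ := fun h => hXY i₁ hi₁ (h ▸ hbY)
      have hbi₂ : b ≠ i₂ := fun h => hXY i₂ hi₂X (h ▸ hbY)
      by_cases hbU : b + 1 ∈ U
      · exact mem_union_right _ (mem_image.2 ⟨b + 1, hbU, by simp⟩)
      refine mem_union_left _ ?_
      by_cases hbj' : b = j
      · simp [hbj']
      have hbX : b + 1 ∈ X := by
        by_contra h
        exact hbU (mem_filter.2 ⟨mem_range.2 (by omega), h, hbY'⟩)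
      have := hi₁min _ hbX
      have hbj1 : b + 1 ≠ j := fun h => hbY' (h ▸ hj)
      have := hi₂max (b + 1) (mem_filter.2 ⟨hbX, by omega⟩)
      by_cases hb1 : b + 1 = i₁
      · simp [← hb1]
      · exact mem_union_left _ (mem_filter.2 ⟨mem_range.2 hbn, by omega, by omega, hbY, hbY'⟩)
    have h1 := card_le_card hsub
    have h2 := card_union_le (P ∪ {i₁ - 1, j}) (U.image (· - 1))
    have h3 : #(U.image (· - 1)) ≤ #U := card_image_le
    omega
  have h5 := card_union_le P {i₁ - 1, j}
  have h6 : #({i₁ - 1, j} : Finset ℕ) ≤ 2 := card_le_two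
  omega

open scoped Classical in
-- For i in `X`, `h2` and `h3` place every neighbour in `Y` at i+1 or at the top of an ascent of
-- `Y`. Ascents exceed descents by at most one, so there are O(η) such neighbours. At most η
-- positions lie in neither set; their rows and columns are bounded trivially.
theorem card_adj_outside_le (hη : n ≤ 2 * δ + η) (hX : X ⊆ range n) (hY : Y ⊆ range n)
    (hδX : δ ≤ #X) (hδY : δ ≤ #Y) (hlast : n - 1 ∉ Y)
    (hrow : ∀ i < n, δ ≤ #{j ∈ range n | e i j}) (hcol : ∀ j < n, δ ≤ #{i ∈ range n | e i j})
    (h1 : Disjoint X Y) (h2 : ∀ i ∈ X, ∀ j ∈ Y, j < i → ¬ e i j)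
    (h3 : ∀ i ∈ X, ∀ j ∈ Y, i < j → j + 1 < n → ¬ e i (j + 1))
    (h4 : ∀ i ∈ X, ∀ j ∈ Y, i < j → ∀ a, j + 1 < a → a < n → e i a → ¬ e a (j + 1))
    (h5 : ∀ i ∈ X, ∀ j ∈ Y, i < j → j + 1 < n → ∀ b < i, e i (b + 1) → ¬ e b (j + 1))
    (h6 : ∀ i ∈ X, ∀ j ∈ Y, i < j → j + 1 < n → ∀ b, i < b → b < j → e i (b + 1) →
      ¬ e b (j + 1)) :
    ∑ i ∈ range n \ Y, #{j ∈ range n \ X | e i j} ≤ n * (7 * η + 6) := by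
  have hXY : ∀ i ∈ X, i ∉ Y := fun i hi => disjoint_left.1 h1 hi
  have hXYc : #X + #Y ≤ n := by
    rw [← card_union_of_disjoint h1, ← card_range n]
    exact card_le_card (union_subset hX hY)
  have hrowX : ∀ i ∈ X, #{j ∈ Y | e i j} ≤ 5 * η + 6 := by
    intro i hi
    obtain ⟨i₁, hi₁, hi₁min⟩ := exists_min_image X id ⟨i, hi⟩
    rcases Y.eq_empty_or_nonempty with rfl | hYne
    · simp
    obtain ⟨j, hj, hjmax⟩ := exists_max_image Y id hYne
    simp only [id] at hi₁min hjmax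
    by_cases hij : i₁ < j
    · have hD := card_descents_le hη hX hY hδX hδY hlast hrow hcol h1 h2 h3 h4 h5 h6 hi₁ hi₁min hj
        hjmax hij
      have hA := card_ascents_le n Y
      have hsub : {k ∈ Y | e i k} ⊆
          insert (i + 1) ({b ∈ range n | b ∉ Y ∧ b + 1 ∈ Y}.image (· + 1)) := by
        intro k hk
        obtain ⟨hkY, hek⟩ := mem_filter.1 hk
        have hkn := mem_range.1 (hY hkY)
        have hki : ¬ k < i := fun h => h2 i hi k hkY h hek
        have hki' : k ≠ i := fun h => hXY i hi (h ▸ hkY)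
        rw [mem_insert]
        by_cases hk1 : k = i + 1
        · exact Or.inl hk1
        · refine Or.inr (mem_image.2 ⟨k - 1, mem_filter.2 ⟨mem_range.2 (by omega), ?_, ?_⟩, by omega⟩)
          · intro h
            refine h3 i hi (k - 1) h (by omega) (by omega) ?_
            rwa [Nat.sub_add_cancel (by omega)]
          · rwa [Nat.sub_add_cancel (by omega)]
      have hc := card_le_card hsub
      have hc2 := card_insert_le (i + 1) ({b ∈ range n | b ∉ Y ∧ b + 1 ∈ Y}.image (· + 1))
      have hc3 : #({b ∈ range n | b ∉ Y ∧ b + 1 ∈ Y}.image (· + 1)) ≤ _ := card_image_le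
      omega
    · have : {k ∈ Y | e i k} = ∅ := by
        refine filter_eq_empty_iff.2 fun k hk => h2 i hi k hk ?_
        have := hjmax k hk
        have := hi₁min i hi
        have : k ≠ i := fun h => hXY i hi (h ▸ hk)
        omega
      simp [this]
  have hsplit : ∀ i, #{j ∈ range n \ X | e i j} ≤ #{j ∈ Y | e i j} + η := by
    intro i
    have hsub : {j ∈ range n \ X | e i j} ⊆ {j ∈ Y | e i j} ∪ (range n \ (X ∪ Y)) := by
      intro j hj
      simp only [mem_filter, mem_union, mem_sdiff] at hj ⊢
      tauto
    have hc := card_le_card hsub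
    have hc2 := card_union_le {j ∈ Y | e i j} (range n \ (X ∪ Y))
    have hc3 : #(range n \ (X ∪ Y)) = _ := card_sdiff_of_subset (union_subset hX hY)
    rw [card_union_of_disjoint h1, card_range] at hc3
    omega
  have hdec : range n \ Y ⊆ X ∪ (range n \ (X ∪ Y)) := by
    intro j hj
    simp only [mem_union, mem_sdiff] at hj ⊢
    tauto
  have hc3 : #(range n \ (X ∪ Y)) = _ := card_sdiff_of_subset (union_subset hX hY)
  rw [card_union_of_disjoint h1, card_range] at hc3
  calc ∑ i ∈ range n \ Y, #{j ∈ range n \ X | e i j}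
      ≤ ∑ i ∈ X ∪ (range n \ (X ∪ Y)), #{j ∈ range n \ X | e i j} :=
        sum_le_sum_of_subset hdec
    _ ≤ ∑ i ∈ X, #{j ∈ range n \ X | e i j} +
          ∑ i ∈ range n \ (X ∪ Y), #{j ∈ range n \ X | e i j} := by
        rw [sum_union]
        rw [disjoint_left]
        intro a ha hb
        simp [ha] at hb
    _ ≤ ∑ _i ∈ X, (6 * η + 6) + ∑ _i ∈ range n \ (X ∪ Y), n := by
        gcongr with i hi i hi
        · have := hsplit i
          have := hrowX i hi
          omega
        · refine (card_le_card ((filter_subset _ _).trans sdiff_subset)).trans (card_range n).le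
    _ ≤ n * (7 * η + 6) := by
        simp only [sum_const, smul_eq_mul]
        have e1 : #X * (6 * η + 6) ≤ n * (6 * η + 6) := Nat.mul_le_mul_right _ (by omega)
        have e2 : #(range n \ (X ∪ Y)) * n ≤ η * n := Nat.mul_le_mul_right _ (by omega)
        calc _ ≤ n * (6 * η + 6) + η * n := by omega
          _ = _ := by ring

end ExchangeCount

/-! ### Balanced bisections by the hyperbolic cosine method -/

section Discrepancy

open Finset

/-- Signs can be chosen so that all of a family of signed sums have small hyperbolic cosine. -/
theorem exists_signs_sum_cosh_le {ι : Type*} [Fintype ι] (l : ℝ) (n : ℕ) (a : ι → Fin n → ℝ)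
    (ha : ∀ i k, |a i k| ≤ 1) :
    ∃ σ : Fin n → Bool, ∑ i, Real.cosh (l * ∑ k, (if σ k then a i k else -a i k)) ≤
      Fintype.card ι * Real.cosh l ^ n := by
  induction n with
  | zero => exact ⟨fun _ => true, by simp⟩
  | succ n ih =>
    obtain ⟨σ, hσ⟩ := ih (fun i k => a i k.castSucc) (fun i k => ha i _)
    -- By the addition formula, the totals for the two choices of the last sign average to at most
    -- cosh l times the previous total, so they cannot both be too large.
    by_contra! hcon
    have h1 := hcon (Fin.snoc σ true)
    have h2 := hcon (Fin.snoc σ false)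
    simp only [Fin.sum_univ_castSucc, Fin.snoc_castSucc, Fin.snoc_last, if_true,
      Bool.false_eq_true, if_false] at h1 h2
    have h3 : ∀ i, Real.cosh (l * (∑ k : Fin n, (if σ k then a i k.castSucc else -a i k.castSucc) +
          a i (Fin.last n))) +
        Real.cosh (l * (∑ k : Fin n, (if σ k then a i k.castSucc else -a i k.castSucc) +
          -a i (Fin.last n))) ≤
        2 * (Real.cosh (l * ∑ k : Fin n, (if σ k then a i k.castSucc else -a i k.castSucc)) *
          Real.cosh l) := by
      intro i
      rw [mul_add, mul_add, mul_neg, ← sub_eq_add_neg, Real.cosh_add, Real.cosh_sub]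
      have : Real.cosh (l * a i (Fin.last n)) ≤ Real.cosh l := by
        rw [Real.cosh_le_cosh, abs_mul]
        exact mul_le_of_le_one_right (abs_nonneg _) (ha i _)
      nlinarith [Real.cosh_pos
        (l * ∑ k : Fin n, (if σ k then a i k.castSucc else -a i k.castSucc))]
    have h4 := Finset.sum_le_sum fun i (_ : i ∈ (Finset.univ : Finset ι)) => h3 i
    rw [Finset.sum_add_distrib, ← Finset.mul_sum, ← Finset.sum_mul] at h4
    have h5 := mul_le_mul_of_nonneg_right hσ (Real.cosh_pos l).le
    rw [pow_succ] at h1 h2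
    linarith

theorem exists_signs_abs_sum_le {ι : Type*} [Fintype ι] {l : ℝ} (hl : 0 < l) {n : ℕ}
    (hι : 2 * (Fintype.card ι : ℝ) ≤ Real.exp (l ^ 2 * n / 2)) (a : ι → Fin n → ℝ)
    (ha : ∀ i k, |a i k| ≤ 1) :
    ∃ σ : Fin n → Bool, ∀ i, |∑ k, (if σ k then a i k else -a i k)| ≤ l * n := by
  obtain ⟨σ, hσ⟩ := exists_signs_sum_cosh_le l n a ha
  refine ⟨σ, fun i => ?_⟩
  set u := ∑ k, (if σ k then a i k else -a i k) with hu
  have h1 : Real.cosh (l * u) ≤ Fintype.card ι * Real.cosh l ^ n :=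
    (Finset.single_le_sum (f := fun i => Real.cosh (l * ∑ k, (if σ k then a i k else -a i k)))
      (fun i _ => (Real.cosh_pos _).le) (Finset.mem_univ i)).trans hσ
  have h2 : Real.cosh l ^ n ≤ Real.exp (l ^ 2 * n / 2) := by
    calc Real.cosh l ^ n ≤ Real.exp (l ^ 2 / 2) ^ n :=
          pow_le_pow_left₀ (Real.cosh_pos l).le (Real.cosh_le_exp_half_sq l) n
      _ = Real.exp (l ^ 2 * n / 2) := by rw [← Real.exp_nat_mul]; ring_nf
  have h3 : Real.exp (l * |u|) ≤ 2 * Real.cosh (l * u) := by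
    rw [← Real.cosh_abs, abs_mul, abs_of_pos hl, Real.cosh_eq]
    have := Real.exp_pos (-(l * |u|))
    linarith
  have h4 : Real.exp (l * |u|) ≤ Real.exp (l ^ 2 * n) := by
    have e : Real.exp (l ^ 2 * n) = Real.exp (l ^ 2 * n / 2) * Real.exp (l ^ 2 * n / 2) := by
      rw [← Real.exp_add]; ring_nf
    rw [e]
    have := mul_le_mul_of_nonneg_left h2 (Nat.cast_nonneg (Fintype.card ι) : (0 : ℝ) ≤ _)
    nlinarith [Real.exp_pos (l ^ 2 * n / 2)]
  have h5 := Real.exp_le_exp.1 h4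
  have : l * |u| ≤ l * (l * n) := by linarith [h5, sq l, mul_assoc l l (n : ℝ)]
  exact le_of_mul_le_mul_left this hl

open scoped Classical in
/-- A set of size `2n` has a bisection that nearly bisects all sets of a given family. -/
theorem exists_bisection {V ι : Type*} [Fintype V] [Fintype ι] {l : ℝ} (hl : 0 < l) {n : ℕ}
    (hV : Fintype.card V = 2 * n)
    (hι : 2 * (Fintype.card ι : ℝ) ≤ Real.exp (l ^ 2 * n / 2)) (F : ι → Finset V) :
    ∃ S : Finset V, #S = n ∧ #Sᶜ = n ∧
      ∀ i, |(#(F i ∩ S) : ℝ) - #(F i ∩ Sᶜ)| ≤ l * n := by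
  -- The vertices are paired off and the sign σ k selects which member of pair k enters `S`, so the
  -- bisection is automatically exact.
  obtain ⟨φ⟩ : Nonempty (Fin n × Bool ≃ V) := by
    rw [← Fintype.card_eq]; simp [hV, mul_comm]
  let a : ι → Fin n → ℝ := fun i k =>
    (if φ (k, true) ∈ F i then 1 else 0) - (if φ (k, false) ∈ F i then 1 else 0)
  obtain ⟨σ, hσ⟩ := exists_signs_abs_sum_le hl hι a (fun i k => by
    simp only [a]; split_ifs <;> simp)
  let S : Finset V := univ.image fun k => φ (k, σ k)
  have hS : #S = n := by
    rw [card_image_of_injective _ (fun k k' h => by simpa using congrArg Prod.fst (φ.injective h))]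
    simp
  have hmem : ∀ k b, φ (k, b) ∈ S ↔ b = σ k := by
    intro k b
    simp only [S, mem_image, mem_univ, true_and, EmbeddingLike.apply_eq_iff_eq, Prod.mk.injEq]
    constructor
    · rintro ⟨k, rfl, rfl⟩; rfl
    · rintro rfl; exact ⟨k, rfl, rfl⟩
  refine ⟨S, hS, by rw [card_compl, hS, hV]; omega, fun i => ?_⟩
  convert hσ i using 2
  have hsum : (#(F i ∩ S) : ℝ) - #(F i ∩ Sᶜ) =
      ∑ v, ((if v ∈ F i ∧ v ∈ S then 1 else 0) - (if v ∈ F i ∧ v ∉ S then 1 else 0) : ℝ) := by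
    rw [sum_sub_distrib, sum_boole, sum_boole]
    congr 3 <;> ext v <;> simp
  rw [hsum, ← φ.sum_comp, Fintype.sum_prod_type]
  refine sum_congr rfl fun k _ => ?_
  simp only [Fintype.sum_bool, hmem, a]
  cases σ k <;> simp <;> ring

end Discrepancy

/-! ### Cyclic orderings of minimum cost -/

section ClosedCost

open Finset

variable {V : Type*} (c : V → V → ℕ)

/-- The total cost of the cyclically consecutive pairs of a list. -/
def closedCost : List V → ℕ
  | [] => 0
  | a :: l => pathCost c (a :: l ++ [a])

theorem closedCost_eq {L : List V} {x y : V} (hy : L.head? = some y) (hx : L.getLast? = some x) :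
    closedCost c L = pathCost c L + c x y := by
  obtain ⟨L', rfl⟩ := List.head?_eq_some_iff.1 hy
  rw [closedCost, pathCost_append c _ [y] x y hx rfl]
  rfl

theorem closedCost_append_comm {A B : List V} (hA : A ≠ []) (hB : B ≠ []) :
    closedCost c (A ++ B) = closedCost c (B ++ A) := by
  have hA1 := List.head?_eq_some_head hA
  have hB1 := List.head?_eq_some_head hB
  have hA2 := List.getLast?_eq_some_getLast hA
  have hB2 := List.getLast?_eq_some_getLast hB
  rw [closedCost_eq c (L := A ++ B) (by rw [List.head?_append, hA1]; rfl)
      (by rw [List.getLast?_append, hB2]; rfl),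
    closedCost_eq c (L := B ++ A) (by rw [List.head?_append, hB1]; rfl)
      (by rw [List.getLast?_append, hA2]; rfl),
    pathCost_append c A B _ _ hA2 hB1, pathCost_append c B A _ _ hB2 hA1]
  ring

theorem pathCost_seg (g : ℕ → V) (N : ℕ) :
    pathCost c (seg g 0 (N + 1)) = ∑ k ∈ range N, c (g k) (g (k + 1)) := by
  induction N with
  | zero => simp [seg, pathCost]
  | succ N ih =>
    rw [seg_append g (Nat.zero_le (N + 1)) (Nat.le_succ _),
      pathCost_append c _ _ _ _ (getLast?_seg g (by omega)) (head?_seg g (by omega)), ih,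
      sum_range_succ]
    simp [seg, pathCost]

theorem length_seg (g : ℕ → V) (N : ℕ) : (seg g 0 N).length = N := by
  simp [seg]

theorem exists_eq_seg [Nonempty V] (L : List V) : ∃ g : ℕ → V, L = seg g 0 L.length := by
  inhabit V
  refine ⟨fun k => L.getD k default, List.ext_getElem (length_seg _ _).symm fun k h1 h2 => ?_⟩
  simp [seg, List.Ico, h1]

theorem closedCost_seg (g : ℕ → V) {N : ℕ} (hN : 0 < N) :
    closedCost c (seg g 0 N) = ∑ k ∈ range (N - 1), c (g k) (g (k + 1)) + c (g (N - 1)) (g 0) := by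
  obtain ⟨N, rfl⟩ : ∃ k, N = k + 1 := ⟨N - 1, by omega⟩
  rw [closedCost_eq c (head?_seg g hN) (getLast?_seg g hN), pathCost_seg]
  rfl

/-- A cyclic ordering of minimum cost either has cost zero, or can be cut into a tight ordering. -/
theorem exists_closedCost_min (hc : ∀ a b, c a b = c b a) (L₀ : List V) (hL₀ : L₀ ≠ []) :
    ∃ L : List V, L.Perm L₀ ∧ (∀ L', L'.Perm L₀ → closedCost c L ≤ closedCost c L') ∧
      (closedCost c L = 0 ∨ ∃ m, IsTight c L₀ m L ∧
        ∀ L x y, IsTight c L₀ m L → L.head? = some y → L.getLast? = some x → c y x ≠ 0) := by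
  obtain ⟨L, hL, hmin⟩ := WellFounded.has_min (measure (closedCost c)).wf {L | L.Perm L₀}
    ⟨L₀, List.Perm.refl _⟩
  replace hmin : ∀ L', L'.Perm L₀ → closedCost c L ≤ closedCost c L' := fun L' h =>
    not_lt.1 (hmin L' h)
  by_cases h0 : closedCost c L = 0
  · exact ⟨L, hL, hmin, Or.inl h0⟩
  have hLne : L ≠ [] := by
    rintro rfl
    exact hL₀ (List.nil_perm.1 hL)
  -- Rotate the cyclic ordering so that a pair of positive cost is the closing one.
  obtain ⟨L', hL', heq, x, y, hy, hx, hxy⟩ : ∃ L' : List V, L'.Perm L₀ ∧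
      closedCost c L' = closedCost c L ∧
      ∃ x y, L'.head? = some y ∧ L'.getLast? = some x ∧ c x y ≠ 0 := by
    have : Nonempty V := ⟨L.head hLne⟩
    obtain ⟨g, hg⟩ := exists_eq_seg L
    have hN : 0 < L.length := List.length_pos_iff.2 hLne
    set N := L.length
    rw [hg, closedCost_seg c g hN] at h0
    by_cases hlast : c (g (N - 1)) (g 0) = 0
    · rw [hlast, add_zero, sum_eq_zero_iff] at h0
      push Not at h0
      obtain ⟨k, hk, hk0⟩ := h0
      have hk := mem_range.1 hk
      have hne : ∀ {a b}, a < b → seg g a b ≠ [] := fun h h' => by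
        have := head?_seg g h
        simp [h'] at this
      have h1 : L = seg g 0 (k + 1) ++ seg g (k + 1) N := by
        rw [← seg_append g (Nat.zero_le _) (by omega)]; exact hg
      refine ⟨seg g (k + 1) N ++ seg g 0 (k + 1), ?_, ?_, g k, g (k + 1), ?_, ?_, hk0⟩
      · exact List.perm_append_comm.trans (h1 ▸ hL)
      · rw [h1]
        exact closedCost_append_comm c (hne (by omega)) (hne (by omega))
      · rw [List.head?_append, head?_seg g (by omega)]; rfl
      · rw [List.getLast?_append, getLast?_seg g (by omega)]; rfl
    · exact ⟨L, hL, rfl, g (N - 1), g 0, by rw [hg]; exact head?_seg g hN,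
        by rw [hg]; exact getLast?_seg g hN, hlast⟩
  have hcl := closedCost_eq c hy hx
  -- With m one less than the minimum, a tight ordering with free closing pair would be a cyclic
  -- ordering below the minimum.
  refine ⟨L', hL', fun M hM => heq.trans_le (hmin M hM), Or.inr ⟨closedCost c L - 1,
    ⟨hL', by omega⟩, fun M u v hM hv hu huv => ?_⟩⟩
  have h1 := hmin M hM.1
  rw [closedCost_eq c hv hu, hc u v, huv] at h1
  have := hM.2
  omega

end ClosedCost

/-! ### Hamiltonicity of nearly Dirac bipartite graphs -/

section Bipartite

open Finset

variable {V : Type*} (S : Finset V) (R : V → V → Prop)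

/-- Two vertices on different sides of a bipartition are joined by an edge directed out of `S`. -/
def CrossAdj (u v : V) : Prop := (u ∈ S ∧ v ∉ S ∧ R u v) ∨ (v ∈ S ∧ u ∉ S ∧ R v u)

theorem CrossAdj.symm {S : Finset V} {R : V → V → Prop} {u v : V} (h : CrossAdj S R u v) :
    CrossAdj S R v u := Or.symm h

open scoped Classical in
/-- The cost of a pair: zero for an edge, one for a non-edge across the bipartition, and `M` for a
pair inside one of the sides. -/
noncomputable def crossCost (M : ℕ) (u v : V) : ℕ :=
  if CrossAdj S R u v then 0 else if (u ∈ S ↔ v ∈ S) then M + 1 else 1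

theorem crossCost_comm (M : ℕ) (u v : V) : crossCost S R M u v = crossCost S R M v u := by
  have h1 : CrossAdj S R u v ↔ CrossAdj S R v u := ⟨.symm, .symm⟩
  have h2 : (u ∈ S ↔ v ∈ S) ↔ (v ∈ S ↔ u ∈ S) := Iff.comm
  unfold crossCost
  split_ifs <;> tauto

theorem crossCost_eq_zero {M : ℕ} {u v : V} : crossCost S R M u v = 0 ↔ CrossAdj S R u v := by
  unfold crossCost
  split_ifs <;> simp_all

theorem crossCost_le_one {M : ℕ} {u v : V} (h : u ∈ S ↔ v ∉ S) : crossCost S R M u v ≤ 1 := by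
  unfold crossCost
  split_ifs with h1 h2
  · simp
  · tauto
  · simp

theorem mem_iff_notMem_of_crossCost_le {M : ℕ} {u v : V} (h : crossCost S R M u v ≤ M) :
    u ∈ S ↔ v ∉ S := by
  unfold crossCost at h
  split_ifs at h with h1 h2
  · rcases h1 with h1 | h1 <;> tauto
  · omega
  · tauto

variable [Fintype V]

open scoped Classical in
theorem exists_alternating_seg {n : ℕ} (hn : 0 < n) (hS : #S = n) (hS' : #Sᶜ = n) :
    ∃ g : ℕ → V, (seg g 0 (2 * n)).Perm (univ : Finset V).toList ∧ ∀ i < n, g (2 * i) ∉ S ∧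
      g (2 * i + 1) ∈ S := by
  let σ := S.equivFinOfCardEq hS
  let τ := Sᶜ.equivFinOfCardEq hS'
  have : NeZero n := ⟨hn.ne'⟩
  let g : ℕ → V := fun k => if Even k then τ.symm (Fin.ofNat n (k / 2)) else
    σ.symm (Fin.ofNat n (k / 2))
  have h0 : ∀ i, g (2 * i) = τ.symm (Fin.ofNat n i) := fun i => by simp [g]
  have h1 : ∀ i, g (2 * i + 1) = σ.symm (Fin.ofNat n i) := fun i => by
    have : (2 * i + 1) / 2 = i := by omega
    simp [g, this]
  have h0S : ∀ i, g (2 * i) ∉ S := fun i => by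
    rw [h0]; exact mem_compl.1 (τ.symm (Fin.ofNat n i)).2
  have h1S : ∀ i, g (2 * i + 1) ∈ S := fun i => by
    rw [h1]; exact (σ.symm (Fin.ofNat n i)).2
  refine ⟨g, ?_, fun i _ => ⟨h0S i, h1S i⟩⟩
  rw [List.perm_ext_iff_of_nodup _ (nodup_toList _)]
  · intro v
    simp only [seg, List.mem_map, List.Ico.mem, mem_toList, mem_univ, iff_true]
    by_cases hv : v ∈ S
    · refine ⟨2 * (σ ⟨v, hv⟩ : ℕ) + 1, by omega, ?_⟩
      rw [h1]; simp
    · refine ⟨2 * (τ ⟨v, mem_compl.2 hv⟩ : ℕ), by omega, ?_⟩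
      rw [h0]; simp
  · refine List.Nodup.map_on ?_ (List.Ico.nodup _ _)
    intro a ha b hb hab
    rw [List.Ico.mem] at ha hb
    obtain ⟨i, rfl | rfl⟩ := Nat.even_or_odd' a <;> obtain ⟨j, rfl | rfl⟩ := Nat.even_or_odd' b
    · rw [h0, h0] at hab
      have := congrArg Fin.val (τ.symm.injective (Subtype.ext hab))
      simp only [Fin.val_ofNat, Nat.mod_eq_of_lt (show i < n by omega),
        Nat.mod_eq_of_lt (show j < n by omega)] at this
      omega
    · exact absurd (hab ▸ h1S j) (h0S i)
    · exact absurd (hab ▸ h1S i) (h0S j)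
    · rw [h1, h1] at hab
      have := congrArg Fin.val (σ.symm.injective (Subtype.ext hab))
      simp only [Fin.val_ofNat, Nat.mod_eq_of_lt (show i < n by omega),
        Nat.mod_eq_of_lt (show j < n by omega)] at this
      omega

/-- Either the bipartite graph is Hamiltonian, or it has a tight alternating ordering. -/
theorem exists_hamiltonian_or_tight [DecidableEq V] {n : ℕ} (hn : 0 < n) (hS : #S = n)
    (hS' : #Sᶜ = n) :
    (∃ g : ℕ → V, (seg g 0 (2 * n)).Perm (univ : Finset V).toList ∧
      (∀ k, k + 1 < 2 * n → CrossAdj S R (g k) (g (k + 1))) ∧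
      CrossAdj S R (g (2 * n - 1)) (g 0)) ∨
    ∃ (g : ℕ → V) (m : ℕ), IsTight (crossCost S R (2 * n)) (univ : Finset V).toList m
        (seg g 0 (2 * n)) ∧
      (∀ L x y, IsTight (crossCost S R (2 * n)) (univ : Finset V).toList m L → L.head? = some y →
        L.getLast? = some x → crossCost S R (2 * n) y x ≠ 0) ∧
      ∀ i < n, g (2 * i) ∉ S ∧ g (2 * i + 1) ∈ S := by
  set c := crossCost S R (2 * n) with hc
  have hcomm : ∀ a b, c a b = c b a := crossCost_comm S R _
  have hcard : Fintype.card V = 2 * n := by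
    have := card_compl_add_card S
    omega
  have hlen : (univ : Finset V).toList.length = 2 * n := by simp [hcard]
  have : Nonempty V := Fintype.card_pos_iff.1 (by omega)
  obtain ⟨L, hL, hmin, hcase⟩ := exists_closedCost_min c hcomm (univ : Finset V).toList
    (List.ne_nil_of_length_pos (by omega))
  obtain ⟨g, hg⟩ := exists_eq_seg L
  rw [hL.length_eq, hlen] at hg
  subst hg
  have h2n : 0 < 2 * n := by omega
  rcases hcase with h0 | ⟨m, hm, hend⟩
  · left
    rw [closedCost_seg c g h2n, Nat.add_eq_zero_iff, sum_eq_zero_iff] at h0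
    refine ⟨g, hL, fun k hk => ?_, (crossCost_eq_zero S R).1 h0.2⟩
    exact (crossCost_eq_zero S R).1 (h0.1 k (mem_range.2 (by omega)))
  · right
    -- An alternating ordering costs at most 2n, while a single pair inside one side costs 2n + 1. A
    -- minimum ordering therefore alternates.
    have hle : closedCost c (seg g 0 (2 * n)) ≤ 2 * n := by
      obtain ⟨f, hf, hfS⟩ := exists_alternating_seg S hn hS (by convert hS')
      refine (hmin _ hf).trans ?_
      rw [closedCost_seg c f h2n]
      have h1 : ∀ k ∈ range (2 * n - 1), c (f k) (f (k + 1)) ≤ 1 := by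
        intro k hk
        have hk := mem_range.1 hk
        refine crossCost_le_one S R ?_
        obtain ⟨i, rfl | rfl⟩ := Nat.even_or_odd' k
        · have := hfS i (by omega)
          tauto
        · have h1 := hfS i (by omega)
          have h2 := hfS (i + 1) (by omega)
          rw [show 2 * (i + 1) = 2 * i + 1 + 1 by ring] at h2
          tauto
      have h2 : c (f (2 * n - 1)) (f 0) ≤ 1 := by
        refine crossCost_le_one S R ?_
        have h1 := hfS 0 hn
        have h2 := hfS (n - 1) (by omega)
        rw [show 2 * (n - 1) + 1 = 2 * n - 1 by omega] at h2
        simp only [mul_zero] at h1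
        tauto
      have h3 := sum_le_card_nsmul _ _ _ h1
      simp only [card_range, smul_eq_mul, mul_one] at h3
      omega
    have halt : ∀ k, k + 1 < 2 * n → (g k ∈ S ↔ g (k + 1) ∉ S) := by
      intro k hk
      refine mem_iff_notMem_of_crossCost_le S R (M := 2 * n) ?_
      rw [closedCost_seg c g h2n] at hle
      have := single_le_sum (f := fun k => c (g k) (g (k + 1))) (fun _ _ => Nat.zero_le _)
        (mem_range.2 (show k < 2 * n - 1 by omega))
      simp only [hc] at this hle ⊢
      omega
    have hpar : ∀ i < n, (g (2 * i) ∈ S ↔ g 0 ∈ S) ∧ (g (2 * i + 1) ∈ S ↔ g 0 ∉ S) := by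
      intro i hi
      induction i with
      | zero =>
        have := halt 0 (by omega)
        simp only [mul_zero, zero_add] at this ⊢
        tauto
      | succ i ih =>
        have h1 := ih (by omega)
        have h2 := halt (2 * i + 1) (by omega)
        have h3 := halt (2 * i + 1 + 1) (by omega)
        rw [show 2 * (i + 1) = 2 * i + 1 + 1 by ring]
        tauto
    -- Reversal, if needed, puts `S` at the odd positions.
    by_cases hg0 : g 0 ∈ S
    · have hrev : (seg g 0 (2 * n)).reverse = seg (fun k => g (2 * n - 1 - k)) 0 (2 * n) := by
        refine List.ext_getElem (by simp [seg]) fun k h1 h2 => ?_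
        simp [seg, List.Ico]
      refine ⟨fun k => g (2 * n - 1 - k), m, ?_, hend, fun i hi => ?_⟩
      · rw [← hrev]
        exact ⟨(List.reverse_perm _).trans hm.1, by rw [pathCost_reverse hcomm]; exact hm.2⟩
      · have h1 := hpar (n - 1 - i) (by omega)
        rw [show 2 * (n - 1 - i) + 1 = 2 * n - 1 - 2 * i by omega,
          show 2 * (n - 1 - i) = 2 * n - 1 - (2 * i + 1) by omega] at h1
        tauto
    · refine ⟨g, m, hm, hend, fun i hi => ?_⟩
      have := hpar i hi
      tauto

open scoped Classical in
/-- A balanced bipartite graph of minimum degree at least `δ` is Hamiltonian, unless there are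
vertices `x` and `y` whose non-neighbourhoods span few edges. -/
theorem hamiltonian_or_sparse {n δ η : ℕ} (hn : 0 < n) (hS : #S = n) (hS' : #Sᶜ = n)
    (hη : n ≤ 2 * δ + η) (hout : ∀ s ∈ S, δ ≤ #{t ∈ Sᶜ | R s t})
    (hin : ∀ t ∈ Sᶜ, δ ≤ #{s ∈ S | R s t}) :
    (∃ g : ℕ → V, (seg g 0 (2 * n)).Perm (univ : Finset V).toList ∧
      (∀ k, k + 1 < 2 * n → CrossAdj S R (g k) (g (k + 1))) ∧
      CrossAdj S R (g (2 * n - 1)) (g 0)) ∨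
    ∃ x ∈ S, ∃ y ∈ Sᶜ, #{s ∈ S | R s y} + δ ≤ n ∧ #{t ∈ Sᶜ | R x t} + δ ≤ n ∧
      ∑ s ∈ S with ¬ R s y, #{t ∈ Sᶜ | ¬ R x t ∧ R s t} ≤ n * (7 * η + 6) := by
  refine (exists_hamiltonian_or_tight S R hn hS hS').imp_right ?_
  rintro ⟨g, m, hg, hend, hgS⟩
  have hcomm := crossCost_comm S R (2 * n)
  have hinj : ∀ a < 2 * n, ∀ b < 2 * n, g a = g b → a = b := by
    intro a ha b hb hab
    have hnd := hg.1.nodup_iff.2 (nodup_toList _)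
    exact List.inj_on_of_nodup_map hnd (List.Ico.mem.2 ⟨by omega, ha⟩)
      (List.Ico.mem.2 ⟨by omega, hb⟩) hab
  have hsinj : Set.InjOn (fun i => g (2 * i + 1)) (range n) := by
    intro a ha b hb hab
    have ha := mem_range.1 ha
    have hb := mem_range.1 hb
    have := hinj _ (by omega) _ (by omega) hab
    omega
  have htinj : Set.InjOn (fun i => g (2 * i)) (range n) := by
    intro a ha b hb hab
    have ha := mem_range.1 ha
    have hb := mem_range.1 hb
    have := hinj _ (by omega) _ (by omega) hab
    omega
  have hSim : (range n).image (fun i => g (2 * i + 1)) = S := by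
    refine eq_of_subset_of_card_le (image_subset_iff.2 fun i hi => (hgS i (mem_range.1 hi)).2) ?_
    rw [card_image_of_injOn hsinj, hS, card_range]
  have hTim : (range n).image (fun i => g (2 * i)) = Sᶜ := by
    refine eq_of_subset_of_card_le
      (image_subset_iff.2 fun i hi => mem_compl.2 (hgS i (mem_range.1 hi)).1) ?_
    rw [card_image_of_injOn htinj, hS', card_range]
  have hScard : ∀ P : V → Prop, #{s ∈ S | P s} = #{i ∈ range n | P (g (2 * i + 1))} := by
    intro P
    rw [← hSim, filter_image, card_image_of_injOn (hsinj.mono (filter_subset _ _))]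
  have hTcard : ∀ (P : V → Prop) [DecidablePred P], #{t ∈ Sᶜ | P t} = #{i ∈ range n | P (g (2 * i))} := by
    intro P _
    rw [← hTim, filter_image, card_image_of_injOn (htinj.mono (filter_subset _ _))]
  have hzero : ∀ i < n, ∀ j < n,
      (crossCost S R (2 * n) (g (2 * i)) (g (2 * j + 1)) = 0 ↔ R (g (2 * j + 1)) (g (2 * i))) := by
    intro i hi j hj
    rw [crossCost_eq_zero, CrossAdj]
    have h1 := (hgS i hi).1
    have h2 := (hgS j hj).2
    tauto
  have hlast : 2 * n - 1 = 2 * (n - 1) + 1 := by omega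
  -- The last vertex plays the role of x and the first that of y. Index i stands for position 2i
  -- outside `S` and for position 2i+1 inside `S`.
  set X := {i ∈ range n | R (g (2 * n - 1)) (g (2 * i))} with hX
  set Y := {j ∈ range n | R (g (2 * j + 1)) (g (2 * 0))} with hY
  have hXmem : ∀ i ∈ X, i < n ∧ crossCost S R (2 * n) (g (2 * i)) (g (2 * n - 1)) = 0 := by
    intro i hi
    obtain ⟨hin, hi⟩ := mem_filter.1 hi
    have hin := mem_range.1 hin
    rw [hlast] at hi ⊢
    exact ⟨hin, (hzero i hin _ (by omega)).2 hi⟩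
  have hYmem : ∀ j ∈ Y, j < n ∧ crossCost S R (2 * n) (g 0) (g (2 * j + 1)) = 0 := by
    intro j hj
    obtain ⟨hjn, hj⟩ := mem_filter.1 hj
    have hjn := mem_range.1 hjn
    exact ⟨hjn, (hzero 0 hn j hjn).2 hj⟩
  have hlastY : n - 1 ∉ Y := by
    intro h
    have h1 := (hYmem _ h).2
    rw [← hlast] at h1
    exact hend _ _ _ hg (head?_seg g (by omega)) (getLast?_seg g (by omega)) h1
  have hdisj : Disjoint X Y := by
    rw [disjoint_left]
    intro i hiX hiY
    obtain ⟨hin, hx⟩ := hXmem i hiX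
    have hne : i ≠ n - 1 := fun h => hlastY (h ▸ hiY)
    exact two_exchange hcomm hend hg (by omega) hx (hYmem i hiY).2
  have hx : g (2 * n - 1) ∈ S := by
    rw [hlast]; exact (hgS _ (by omega)).2
  have hy : g (2 * 0) ∈ Sᶜ := mem_compl.2 (hgS 0 hn).1
  have hXc : #{t ∈ Sᶜ | R (g (2 * n - 1)) t} = #X := hTcard _
  have hYc : #{s ∈ S | R s (g (2 * 0))} = #Y := hScard _
  have hδX : δ ≤ #X := hXc ▸ hout _ hx
  have hδY : δ ≤ #Y := hYc ▸ hin _ hy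
  have hXYc : #X + #Y ≤ n := by
    rw [← card_union_of_disjoint hdisj]
    simpa using card_le_card (union_subset (filter_subset _ _) (filter_subset _ _) :
      X ∪ Y ⊆ range n)
  refine ⟨_, hx, _, hy, by omega, by omega, ?_⟩
  have key := card_adj_outside_le (e := fun i j => R (g (2 * i + 1)) (g (2 * j))) hη
    (filter_subset _ _ : X ⊆ range n) (filter_subset _ _ : Y ⊆ range n) hδX hδY hlastY
    (fun i hi => (hout _ (hgS i hi).2).trans (hTcard _).le)
    (fun j hj => (hin _ (mem_compl.2 (hgS j hj).1)).trans (hScard _).le) hdisj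
    (by
      intro i hi j hj hji he
      obtain ⟨hin, hxi⟩ := hXmem i hi
      obtain ⟨hjn, hyj⟩ := hYmem j hj
      by_cases h : i = n - 1
      · refine disjoint_left.1 hdisj (mem_filter.2 ⟨mem_range.2 hjn, ?_⟩) hj
        rw [hlast, ← h]
        exact he
      · exact three_exchange_left hcomm hend hg (by omega) (by omega) hxi hyj
          ((hzero j hjn i hin).2 he))
    (by
      intro i hi j hj hij hjn he
      obtain ⟨hin, hxi⟩ := hXmem i hi
      exact three_exchange_right hcomm hend hg (show 2 * i < 2 * j + 1 by omega) (by omega) hxi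
        (hYmem j hj).2 ((hzero (j + 1) hjn i hin).2 he))
    (by
      intro i hi j hj hij a hja han he he'
      obtain ⟨hin, hxi⟩ := hXmem i hi
      exact four_exchange_right hcomm hend hg (show 2 * i < 2 * j + 1 by omega) hxi
        (hYmem j hj).2 (show 2 * j + 1 < 2 * a by omega) (by omega) ((hzero a han i hin).2 he)
        ((hzero (j + 1) (by omega) a han).2 he'))
    (by
      intro i hi j hj hij hjn b hb he he'
      obtain ⟨hin, hxi⟩ := hXmem i hi
      exact four_exchange_left hcomm hend hg (show 2 * i < 2 * j + 1 by omega) (by omega) hxi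
        (hYmem j hj).2 (show 2 * b + 1 + 1 ≤ 2 * i by omega)
        ((hzero (b + 1) (by omega) i hin).2 he) ((hzero (j + 1) hjn b (by omega)).2 he'))
    (by
      intro i hi j hj hij hjn b hib hbj he he'
      obtain ⟨hin, hxi⟩ := hXmem i hi
      exact four_exchange_middle hcomm hend hg (show 2 * i < 2 * j + 1 by omega) (by omega) hxi
        (hYmem j hj).2 (show 2 * i + 1 ≤ 2 * b + 1 by omega) (show 2 * b + 1 + 1 ≤ 2 * j + 1 by omega)
        ((hzero (b + 1) (by omega) i hin).2 he) ((hzero (j + 1) hjn b (by omega)).2 he'))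
  refine le_of_eq_of_le ?_ key
  have h1 : {s ∈ S | ¬ R s (g (2 * 0))} = (range n \ Y).image (fun i => g (2 * i + 1)) := by
    rw [← hSim, filter_image]
    congr 1
    ext i
    simp only [hY, mem_filter, mem_sdiff]
    tauto
  rw [h1, sum_image (hsinj.mono sdiff_subset)]
  refine sum_congr rfl fun i _ => ?_
  rw [hTcard]
  congr 1
  ext j
  simp only [mem_filter, mem_sdiff]
  tauto

end Bipartite

/-! ### Using non-extremality, and the final contradiction -/

section NonExtremal

open Finset

variable {V : Type*} (D : Digraph V)

open scoped Classical in
/-- In a digraph that is not extremal, two sets of about half of the vertices span many edges. -/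
theorem Digraph.exists_many_of_not_isExtremal {n : ℕ} {α : ℝ} (hα : 0 < α)
    (hD : ¬ D.IsExtremal n α) {A B : Finset V}
    (hA : (1 - α / 2) * n ≤ #A) (hA' : (#A : ℝ) ≤ (1 + α) * n)
    (hB : (1 - α / 2) * n ≤ #B) (hB' : (#B : ℝ) ≤ (1 + α) * n) :
    α / 2 * n ≤ #{v ∈ A | α * n < D.outDegIn v B} ∨
      α / 2 * n ≤ #{w ∈ B | α * n < D.inDegIn w A} := by
  by_contra! hcon
  obtain ⟨h1, h2⟩ := hcon
  have hpos : 0 ≤ α * n := by positivity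
  -- Deleting the vertices of large degree costs each set less than αn/2 elements, and passing to
  -- subsets only lowers the remaining degrees.
  refine hD ⟨{v ∈ A | ¬ α * n < D.outDegIn v B}, {w ∈ B | ¬ α * n < D.inDegIn w A},
    ⟨?_, ?_⟩, ⟨?_, ?_⟩, ?_, ?_⟩
  · have := card_filter_add_card_filter_not (s := A) fun v => α * n < D.outDegIn v B
    have : (#A : ℝ) = _ := congrArg Nat.cast this.symm
    push_cast at this
    linarith
  · exact (Nat.cast_le.2 (card_le_card (filter_subset _ _))).trans hA'
  · have := card_filter_add_card_filter_not (s := B) fun v => α * n < D.inDegIn v A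
    have : (#B : ℝ) = _ := congrArg Nat.cast this.symm
    push_cast at this
    linarith
  · exact (Nat.cast_le.2 (card_le_card (filter_subset _ _))).trans hB'
  · rw [← Nat.le_floor_iff hpos]
    refine Finset.sup_le fun v hv => ?_
    rw [Nat.le_floor_iff hpos]
    refine le_trans (Nat.cast_le.2 (card_le_card ?_)) (not_lt.1 (mem_filter.1 hv).2)
    exact filter_subset_filter _ (filter_subset _ _)
  · rw [← Nat.le_floor_iff hpos]
    refine Finset.sup_le fun v hv => ?_
    rw [Nat.le_floor_iff hpos]
    refine le_trans (Nat.cast_le.2 (card_le_card ?_)) (not_lt.1 (mem_filter.1 hv).2)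
    exact filter_subset_filter _ (filter_subset _ _)

variable [Fintype V]

theorem Digraph.hasAntidirectedHamiltonianCycle_of_equiv {D : Digraph V} {S : Finset V} {M : ℕ}
    (hM : 1 ≤ M) (γ : Fin (M + 2) ≃ V) (hγ : ∀ k, CrossAdj S D.Adj (γ k) (γ (k + 1))) :
    D.HasAntidirectedHamiltonianCycle := by
  have hcard : Fintype.card V = M + 2 := by rw [← Fintype.card_congr γ, Fintype.card_fin]
  -- All edges of `H` leave `S`, so none can follow another head to tail.
  let H : Digraph V := ⟨fun u v => D.Adj u v ∧ u ∈ S ∧ v ∉ S ∧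
    (γ.symm v = γ.symm u + 1 ∨ γ.symm u = γ.symm v + 1)⟩
  refine ⟨H, fun u v h => h.1, ⟨by omega, ?_, fun u v w h h' => h.2.2.1 h'.2.1⟩⟩
  rw [hcard]
  refine ⟨⟨γ.symm, ?_⟩⟩
  intro u v
  rw [SimpleGraph.cycleGraph_adj, Digraph.toSimpleGraphInclusive, SimpleGraph.fromRel_adj,
    sub_eq_iff_eq_add', sub_eq_iff_eq_add']
  constructor
  · intro h
    have hcr : CrossAdj S D.Adj u v := by
      rcases h with h | h
      · have := hγ (γ.symm v)
        rw [← h] at this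
        simpa using this.symm
      · have := hγ (γ.symm u)
        rw [← h] at this
        simpa using this
    rcases hcr with ⟨h1, h2, h3⟩ | ⟨h1, h2, h3⟩
    · exact ⟨fun huv => h2 (huv ▸ h1), Or.inl ⟨h3, h1, h2, h.symm⟩⟩
    · exact ⟨fun huv => h2 (huv ▸ h1), Or.inr ⟨h3, h1, h2, h⟩⟩
  · rintro ⟨-, h | h⟩
    · exact h.2.2.2.symm
    · exact h.2.2.2

theorem Digraph.hasAntidirectedHamiltonianCycle_of_seg {D : Digraph V} {S : Finset V} {n : ℕ}
    (hn : 2 ≤ n) {g : ℕ → V} (hg : (seg g 0 (2 * n)).Perm (univ : Finset V).toList)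
    (hadj : ∀ k, k + 1 < 2 * n → CrossAdj S D.Adj (g k) (g (k + 1)))
    (hlast : CrossAdj S D.Adj (g (2 * n - 1)) (g 0)) : D.HasAntidirectedHamiltonianCycle := by
  obtain ⟨M, hM⟩ : ∃ M, 2 * n = M + 2 := ⟨2 * n - 2, by omega⟩
  rw [hM] at hg hadj hlast
  have hbij : Function.Bijective (fun k : Fin (M + 2) => g k) := by
    constructor
    · intro a b hab
      have hnd := hg.nodup_iff.2 (nodup_toList _)
      exact Fin.ext (List.inj_on_of_nodup_map hnd (List.Ico.mem.2 ⟨by omega, a.2⟩)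
        (List.Ico.mem.2 ⟨by omega, b.2⟩) hab)
    · intro v
      have hv : v ∈ seg g 0 (M + 2) := hg.mem_iff.2 (by simp)
      obtain ⟨k, hk, rfl⟩ := List.mem_map.1 hv
      exact ⟨⟨k, (List.Ico.mem.1 hk).2⟩, rfl⟩
  refine hasAntidirectedHamiltonianCycle_of_equiv (by omega) (S := S)
    (Equiv.ofBijective _ hbij)
    fun k => ?_
  simp only [Equiv.ofBijective_apply]
  by_cases hk : k = Fin.last (M + 1)
  · subst hk
    simpa using hlast
  · rw [Fin.val_add_one_of_lt (Fin.lt_last_iff_ne_last.2 hk)]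
    refine hadj k ?_
    have := Fin.val_lt_last hk
    omega

open scoped Classical in
theorem half_sub_le_card_inter {F S : Finset V} {d : ℝ}
    (h : |(#(F ∩ S) : ℝ) - #(F ∩ Sᶜ)| ≤ d) :
    ((#F : ℝ) - d) / 2 ≤ #(F ∩ S) ∧ ((#F : ℝ) - d) / 2 ≤ #(F ∩ Sᶜ) := by
  have h1 : #(F ∩ S) + #(F ∩ Sᶜ) = #F := by
    rw [← sdiff_eq_inter_compl]
    exact card_inter_add_card_sdiff F S
  have h2 : (#F : ℝ) = #(F ∩ S) + #(F ∩ Sᶜ) := by exact_mod_cast h1.symm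
  rw [abs_le] at h
  constructor <;> linarith

/-- The sets that a bisection of the vertex set should split evenly. -/
noncomputable def Digraph.testSet (b : ℝ) (i : Fin 6 × V × V) : Finset V :=
  open scoped Classical in
  match i with
  | (0, p, _) => {w | D.Adj p w}
  | (1, p, _) => {v | D.Adj v p}
  | (2, p, q) => {v ∈ ({v | ¬ D.Adj v q} : Finset V) | b < D.outDegIn v {w | ¬ D.Adj p w}}
  | (3, p, q) => {w ∈ ({w | ¬ D.Adj p w} : Finset V) | b < D.inDegIn w {v | ¬ D.Adj v q}}
  | (4, p, q) => {w ∈ ({w | ¬ D.Adj p w} : Finset V) | D.Adj q w}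
  | (5, p, q) => {v ∈ ({v | ¬ D.Adj v q} : Finset V) | D.Adj v p}

theorem mul_le_sum_of_card {ι : Type*} {s t : Finset ι} (hst : s ⊆ t) {f : ι → ℕ} {a b : ℝ}
    (ha : a ≤ #s) (hb : 0 ≤ b) (hf : ∀ i ∈ s, b ≤ f i) : a * b ≤ ((∑ i ∈ t, f i : ℕ) : ℝ) := by
  calc a * b ≤ #s * b := mul_le_mul_of_nonneg_right ha hb
    _ = ∑ _i ∈ s, b := by simp
    _ ≤ ∑ i ∈ s, (f i : ℝ) := sum_le_sum hf
    _ ≤ ∑ i ∈ t, (f i : ℝ) := sum_le_sum_of_subset_of_nonneg hst fun _ _ _ => Nat.cast_nonneg _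
    _ = _ := by push_cast; rfl

open scoped Classical in
-- The vertices x and y are known only after the bisection, so test sets are prepared for all pairs:
-- 6(2n)² = 24n² sets in total, whence `hn2`.
theorem Digraph.hasAntidirectedHamiltonianCycle_of_not_isExtremal {n : ℕ} {α l : ℝ} (hα : 0 < α)
    (hα1 : α < 1) (hl : l = α ^ 2 / 1000) (hn : 2 ≤ n) (hn1 : 1000 ≤ α ^ 2 * n)
    (hn2 : 2 * (24 * (n : ℝ) ^ 2) ≤ Real.exp (l ^ 2 * n / 2))
    (hV : Fintype.card V = 2 * n) (hD : ¬ D.IsExtremal n α)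
    (hdeg : (1 - l) * (n : ℝ) ≤ (D.minSemidegree : ℝ)) :
    D.HasAntidirectedHamiltonianCycle := by
  have hn0 : (0 : ℝ) < n := by exact_mod_cast (by omega : 0 < n)
  have hl0 : 0 < l := by rw [hl]; positivity
  have hlα : 1000 * l ≤ α := by rw [hl]; nlinarith
  have hlα' : 1000 * (l * n) ≤ α * n := by nlinarith
  have hln : 0 < l * n := by positivity
  obtain ⟨S, hS, hS', hbis⟩ := exists_bisection hl0 hV
    (by simp only [Fintype.card_prod, Fintype.card_fin, hV]; push_cast; convert hn2 using 1; ring)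
    (D.testSet (α * n))
  have hout : ∀ v, (1 - l) * (n : ℝ) ≤ #{w | D.Adj v w} := fun v =>
    hdeg.trans (Nat.cast_le.2 ((min_le_left _ _).trans (ciInf_le' _ v)))
  have hin : ∀ v, (1 - l) * (n : ℝ) ≤ #{u | D.Adj u v} := fun v =>
    hdeg.trans (Nat.cast_le.2 ((min_le_right _ _).trans (ciInf_le' _ v)))
  -- Half of (1 - l)n, minus the bisection error ln/2.
  set δ := ⌈(1 / 2 - l) * n⌉₊ with hδ
  have hδle : (1 / 2 - l) * n ≤ δ := Nat.le_ceil _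
  have hη : ((n - 2 * δ : ℕ) : ℝ) ≤ 2 * (l * n) := by
    rcases le_total (2 * δ) n with h | h
    · push_cast [Nat.cast_sub h]; linarith
    · rw [Nat.sub_eq_zero_of_le h]; push_cast; positivity
  have hSc : ∀ P : V → Prop, ({v | P v} : Finset V) ∩ S = {v ∈ S | P v} := fun P => by
    ext; simp [and_comm]
  have hTc : ∀ P : V → Prop, ({v | P v} : Finset V) ∩ Sᶜ = {v ∈ Sᶜ | P v} := fun P => by
    ext; simp [and_comm]
  have hout' : ∀ v, ((#{w | D.Adj v w} : ℝ) - l * n) / 2 ≤ #{t ∈ Sᶜ | D.Adj v t} := fun v => by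
    have := (half_sub_le_card_inter (hbis (0, v, v))).2
    rwa [Digraph.testSet, hTc] at this
  have hin' : ∀ v, ((#{u | D.Adj u v} : ℝ) - l * n) / 2 ≤ #{s ∈ S | D.Adj s v} := fun v => by
    have := (half_sub_le_card_inter (hbis (1, v, v))).1
    rwa [Digraph.testSet, hSc] at this
  rcases hamiltonian_or_sparse S D.Adj (by omega) hS hS' (show n ≤ 2 * δ + (n - 2 * δ) by omega)
    (fun s _ => Nat.ceil_le.2 (by have := hout s; have := hout' s; linarith))
    (fun t _ => Nat.ceil_le.2 (by have := hin t; have := hin' t; linarith)) with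
    ⟨g, hg, hadj, hlast⟩ | ⟨x, hx, y, hy, hyc, hxc, hsum⟩
  · exact hasAntidirectedHamiltonianCycle_of_seg hn hg hadj hlast
  exfalso
  set A : Finset V := {v | ¬ D.Adj v y} with hA
  set B : Finset V := {w | ¬ D.Adj x w} with hB
  have hAc : (#A : ℝ) = 2 * n - #{v | D.Adj v y} := by
    have := card_filter_add_card_filter_not (s := (univ : Finset V)) fun v => D.Adj v y
    rw [card_univ, hV] at this
    have : ((2 * n : ℕ) : ℝ) = _ := congrArg Nat.cast this.symm
    push_cast at this
    linarith
  have hBc : (#B : ℝ) = 2 * n - #{w | D.Adj x w} := by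
    have := card_filter_add_card_filter_not (s := (univ : Finset V)) fun v => D.Adj x v
    rw [card_univ, hV] at this
    have : ((2 * n : ℕ) : ℝ) = _ := congrArg Nat.cast this.symm
    push_cast at this
    linarith
  -- The few neighbours of y in `S` and of x outside `S` bound, through the bisection, their full
  -- degrees by (1 + 3l)n. Hence `A` and `B` have at least (1 - 3l)n elements.
  have hyc' : (#{s ∈ S | D.Adj s y} : ℝ) + δ ≤ n := by exact_mod_cast hyc
  have hxc' : (#{t ∈ Sᶜ | D.Adj x t} : ℝ) + δ ≤ n := by exact_mod_cast hxc
  have hupper : ((∑ s ∈ S with ¬ D.Adj s y, #{t ∈ Sᶜ | ¬ D.Adj x t ∧ D.Adj s t} : ℕ) : ℝ) ≤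
      n * (14 * (l * n) + 6) := by
    refine (Nat.cast_le.2 hsum).trans ?_
    push_cast
    exact mul_le_mul_of_nonneg_left (by linarith) hn0.le
  -- At least αn/2 vertices of one set have more than αn neighbours in the other. Bisecting halves
  -- both numbers up to ln/2, and l ≤ α/1000 leaves αn/8 and αn/4.
  have hlower : (α * n / 8) * (α * n / 4) ≤
      ((∑ s ∈ S with ¬ D.Adj s y, #{t ∈ Sᶜ | ¬ D.Adj x t ∧ D.Adj s t} : ℕ) : ℝ) := by
    have hαn : 0 ≤ α * n := by positivity
    have hinx := hout x
    have hiny := hin y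
    have hox := hout' x
    have hoy := hin' y
    rcases D.exists_many_of_not_isExtremal hα hD (A := A) (B := B) (by linarith) (by linarith)
      (by linarith) (by linarith) with h | h
    · have h1 := (half_sub_le_card_inter (hbis (2, x, y))).1
      change ((#{v ∈ A | α * n < D.outDegIn v B} : ℝ) - _) / 2 ≤ _ at h1
      refine mul_le_sum_of_card (s := D.testSet (α * n) (2, x, y) ∩ S) ?_ (by linarith)
        (by positivity) ?_
      · intro v hv
        simp only [Digraph.testSet, mem_inter, mem_filter] at hv ⊢
        exact ⟨hv.2, hv.1.1.2⟩
      · intro v hv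
        have hv := (mem_filter.1 (mem_inter.1 hv).1).2
        have h2 := (half_sub_le_card_inter (hbis (4, x, v))).2
        change ((D.outDegIn v B : ℝ) - _) / 2 ≤ _ at h2
        change α * n < D.outDegIn v B at hv
        have h3 : D.testSet (α * n) (4, x, v) ∩ Sᶜ = {t ∈ Sᶜ | ¬ D.Adj x t ∧ D.Adj v t} := by
          ext t
          simp only [Digraph.testSet, mem_inter, mem_filter, mem_univ, true_and]
          tauto
        rw [h3] at h2
        linarith
    -- In the second alternative the same edges are counted from their heads.
    · have hcomm : ∑ s ∈ S with ¬ D.Adj s y, #{t ∈ Sᶜ | ¬ D.Adj x t ∧ D.Adj s t} =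
          ∑ t ∈ Sᶜ with ¬ D.Adj x t, #{s ∈ S | ¬ D.Adj s y ∧ D.Adj s t} := by
        simp only [← filter_filter]
        exact sum_card_bipartiteAbove_eq_sum_card_bipartiteBelow D.Adj
      rw [hcomm]
      have h1 := (half_sub_le_card_inter (hbis (3, x, y))).2
      change ((#{v ∈ B | α * n < D.inDegIn v A} : ℝ) - _) / 2 ≤ _ at h1
      refine mul_le_sum_of_card (s := D.testSet (α * n) (3, x, y) ∩ Sᶜ) ?_ (by linarith)
        (by positivity) ?_
      · intro v hv
        simp only [Digraph.testSet, mem_inter, mem_filter] at hv ⊢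
        exact ⟨hv.2, hv.1.1.2⟩
      · intro v hv
        have hv := (mem_filter.1 (mem_inter.1 hv).1).2
        have h2 := (half_sub_le_card_inter (hbis (5, v, y))).1
        change ((D.inDegIn v A : ℝ) - _) / 2 ≤ _ at h2
        change α * n < D.inDegIn v A at hv
        have h3 : D.testSet (α * n) (5, v, y) ∩ S = {s ∈ S | ¬ D.Adj s y ∧ D.Adj s v} := by
          ext t
          simp only [Digraph.testSet, mem_inter, mem_filter, mem_univ, true_and]
          tauto
        rw [h3] at h2
        linarith
  have hfin : (α * n / 8) * (α * n / 4) ≤ n * (14 * (l * n) + 6) := hlower.trans hupper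
  have h5 : n * (α ^ 2 * n / 32) ≤ n * (14 * (l * n) + 6) := by
    calc n * (α ^ 2 * n / 32) = (α * n / 8) * (α * n / 4) := by ring
      _ ≤ _ := hfin
  have h6 := le_of_mul_le_mul_left h5 hn0
  -- Now α²n/32 ≤ 14α²n/1000 + 6, which fails for α²n ≥ 1000.
  rw [hl] at h6
  linarith

theorem exists_forall_sq_le_exp {c : ℝ} (hc : 0 < c) :
    ∃ n₀ : ℕ, ∀ n : ℕ, n₀ ≤ n → 2 * (24 * (n : ℝ) ^ 2) ≤ Real.exp (c * n) := by
  have h := (isLittleO_pow_exp_pos_mul_atTop 2 hc).bound (show (0 : ℝ) < 1 / 48 by norm_num)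
  obtain ⟨n₀, h⟩ := Filter.eventually_atTop.1 (tendsto_natCast_atTop_atTop.eventually h)
  refine ⟨n₀, fun n hn => ?_⟩
  have := h n hn
  rw [Real.norm_of_nonneg (by positivity), Real.norm_of_nonneg (by positivity)] at this
  linarith

end NonExtremal

theorem theorem3p1 :
    ∀ α : ℝ, 0 < α → α < 1 / 32 →
      ∃ ε : ℝ, 0 < ε ∧ ∃ n₀ : ℕ,
        ∀ (n : ℕ), n₀ ≤ n →
        ∀ (V : Type*) [Fintype V] (D : Digraph V),
          Fintype.card V = 2 * n →
          (∀ v : V, ¬ D.Adj v v) →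
          ¬ D.IsExtremal n α →
          (1 - ε) * (n : ℝ) ≤ (D.minSemidegree : ℝ) →
          D.HasAntidirectedHamiltonianCycle := by
  intro α hα hα1
  obtain ⟨n₁, hn₁⟩ := exists_forall_sq_le_exp (c := (α ^ 2 / 1000) ^ 2 / 2) (by positivity)
  obtain ⟨n₂, hn₂⟩ := exists_nat_ge (1000 / α ^ 2)
  refine ⟨α ^ 2 / 1000, by positivity, max (max n₁ n₂) 2, fun n hn V _ D hV _ hD hdeg => ?_⟩
  have h1 : n₁ ≤ n := by omega
  have h2 : n₂ ≤ n := by omega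
  refine D.hasAntidirectedHamiltonianCycle_of_not_isExtremal hα (by linarith) rfl (by omega) ?_ ?_
    hV hD hdeg
  · have h3 : 1000 / α ^ 2 ≤ n := hn₂.trans (Nat.cast_le.2 h2)
    rw [div_le_iff₀ (by positivity)] at h3
    linarith
  · convert hn₁ n h1 using 2
    ring
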